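/- Fix $K,M\in\mathbb N$, a parameter space $\Theta\subseteq\mathbb R^K$, a true parameter $\theta$ in the interior of $\Theta$, and functions $\mu$ and $\Lambda$ on $\Theta$ such that $\mu(t)\in\mathbb R^M$ and $\Lambda(t)\in\mathbb R^{M\times M}$ is symmetric positive definite for $t\in\Theta$. The assumed model is that $x_1,\dots,x_N$ are i.i.d. with distribution $\mathcal N(\mu(\theta),\Lambda(\theta))$; write $Q_N$ for this joint distribution, and let $\bar x_N=\frac1N\sum_{n=1}^N x_n$. Assume that the Fisher information matrix $I(\theta)$ of a single observation of the assumed model (the second-moment matrix of the score $\nabla_\theta\log q_\theta(x)$) exists and is positive definite. Let $\hat\theta_N$ be, $Q_N$-almost surely for every $N\ge1$, a maximizer over $\Theta$ of the Gaussian likelihood $t\mapsto\prod_{n=1}^N q_t(x_n)$, where $q_t$ is the density of $\mathcal N(\mu(t),\Lambda(t))$, and suppose that $\hat\theta_N$ is a measurable function of $\bar x_N$. Write $\varepsilon_N=\hat\theta_N-\theta$, and assume that under the assumed model (i) $\hat\theta_N$ is consistent: $\hat\theta_N\to\theta$ in probability; (ii) $\hat\theta_N$ is asymptotically efficient: $\sqrt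 N\,\varepsilon_N\to\mathcal N(0,I(\theta)^{-1})$ in distribution; (iii) the error has asymptotically bounded kurtosis: there is a constant $C$ such that, for all sufficiently large $N$, $\mathbb E_{Q_N}\|\varepsilon_N\|^4<\infty$ and $\mathbb E_{Q_N}\|\varepsilon_N\|^4\le C\,(\mathbb E_{Q_N}\|\varepsilon_N\|^2)^2$. Let the true data be $x_n=h(\theta)+v_n$, $n=1,2,\dots$, on a probability space with probability measure $P$, where $h$ is a (possibly random) function $\mathbb R^K\to\mathbb R^M$ and the $v_n$ are integrable zero-mean noise vectors of otherwise arbitrary joint distribution (neither independent nor identically distributed in general). Let $\bar P_N$ be the true distribution of $\bar x_N$, let $\bar Q_N=\mathcal N(\mu(\theta),N^{-1}\Lambda(\theta))$, and let $\chi^2(\bar P\|\bar Q)=\mathbb E_{\bar Q}\big[(\tfrac{d\bar P}{d\bar Q}-1)^2\big]$ if $\bar P\ll\bar Q$, and $\infty$ otherwise. If $$\chi^2(\bar P_N\|\bar Q_N)=o(N^2)\qquad(N\to\infty),$$ then $\hat\theta_N$ is MSE-consistent under the true data distribution: $$\lim_{N\to\infty}\mathbb E_P\big[\|\hat\theta_N-\theta\|_2^2\big]=0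 .$$ -/

import Mathlib

open MeasureTheory ProbabilityTheory Filter Topology

/-- `ℝⁿ` with its Euclidean norm. -/
abbrev Vec (n : ℕ) : Type := EuclideanSpace ℝ (Fin n)

/-- The sample mean `x̄ = (1/N) ∑ₙ xₙ` of `N` observations in `ℝᴹ`. -/
noncomputable def sampleMean {M N : ℕ} (x : Fin N → Vec M) : Vec M :=
  (N : ℝ)⁻¹ • ∑ n, x n

/-- The chi-square divergence `χ²(P‖Q) = E_Q[(dP/dQ - 1)²]`, with value `∞` if `P` is not
absolutely continuous with respect to `Q`. -/
noncomputable def chiSqDiv {α : Type*} [MeasurableSpace α] (P Q : Measure α) : ENNReal :=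
  open scoped Classical in
  if P ≪ Q then ∫⁻ y, ENNReal.ofReal (((P.rnDeriv Q y).toReal - 1) ^ 2) ∂Q else ⊤

/-- The Lebesgue density at `x` of the Gaussian distribution on `ℝᴹ` with mean `m` and positive
definite covariance matrix `S`. -/
noncomputable def mvGaussianDensity {M : ℕ} (m : Vec M) (S : Matrix (Fin M) (Fin M) ℝ)
    (x : Vec M) : ℝ :=
  (Real.sqrt ((2 * Real.pi) ^ M * S.det))⁻¹ *
    Real.exp (-(dotProduct (fun i => x i - m i) (S⁻¹.mulVec (fun i => x i - m i))) / 2)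

/-- The likelihood of the parameter `t` for `N` observations that are modelled as i.i.d. with
distribution `𝒩(μ(t), Λ(t))`. -/
noncomputable def gaussianLikelihood {K M N : ℕ} (μ : Vec K → Vec M)
    (Λ : Vec K → Matrix (Fin M) (Fin M) ℝ) (x : Fin N → Vec M) (t : Vec K) : ℝ :=
  ∏ n, mvGaussianDensity (μ t) (Λ t) (x n)

/-- The joint distribution of `N` i.i.d. observations from `𝒩(m, S)`. -/
noncomputable def iidGaussian {M : ℕ} (m : Vec M) (S : Matrix (Fin M) (Fin M) ℝ) (N : ℕ) :
    Measure (Fin N → Vec M) :=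
  Measure.pi (fun _ => multivariateGaussian m S)

/-- `est` is, for almost all data under the assumed model with parameter `θ`, a maximum
likelihood estimate over the parameter space `Θ`. -/
def IsGaussianMLE {K M : ℕ} (Θ : Set (Vec K)) (μ : Vec K → Vec M)
    (Λ : Vec K → Matrix (Fin M) (Fin M) ℝ) (θ : Vec K)
    (est : ∀ N : ℕ, (Fin N → Vec M) → Vec K) : Prop :=
  ∀ N : ℕ, 0 < N → ∀ᵐ x ∂(iidGaussian (μ θ) (Λ θ) N),
    est N x ∈ Θ ∧ ∀ t ∈ Θ, gaussianLikelihood μ Λ x t ≤ gaussianLikelihood μ Λ x (est N x)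

/-- The `k`-th component `∂ log q_θ(x) / ∂θ_k` of the score of a single observation. -/
noncomputable def gaussianScore {K M : ℕ} (μ : Vec K → Vec M)
    (Λ : Vec K → Matrix (Fin M) (Fin M) ℝ) (θ : Vec K) (k : Fin K) (x : Vec M) : ℝ :=
  fderiv ℝ (fun t => Real.log (mvGaussianDensity (μ t) (Λ t) x)) θ (EuclideanSpace.single k 1)

/-- The Fisher information matrix of a single observation from `𝒩(μ(θ), Λ(θ))`. -/
noncomputable def fisherInfo {K M : ℕ} (μ : Vec K → Vec M)
    (Λ : Vec K → Matrix (Fin M) (Fin M) ℝ) (θ : Vec K) : Matrix (Fin K) (Fin K) ℝ :=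
  Matrix.of fun k l => ∫ x, gaussianScore μ Λ θ k x * gaussianScore μ Λ θ l x
    ∂(multivariateGaussian (μ θ) (Λ θ))

/-- The Fisher information matrix at `θ` exists and is positive definite. -/
structure HasFisherInfo {K M : ℕ} (μ : Vec K → Vec M)
    (Λ : Vec K → Matrix (Fin M) (Fin M) ℝ) (θ : Vec K) : Prop where
  differentiable : ∀ᵐ x ∂(multivariateGaussian (μ θ) (Λ θ)),
    DifferentiableAt ℝ (fun t => Real.log (mvGaussianDensity (μ t) (Λ t) x)) θ
  square_integrable : ∀ k, MemLp (gaussianScore μ Λ θ k) 2 (multivariateGaussian (μ θ) (Λ θ))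
  posDef : (fisherInfo μ Λ θ).PosDef

/-- Consistency at `θ`: convergence in probability of the estimators `est N` to `θ` when the
data for sample size `N` have distribution `Q N`. -/
def IsConsistent {K M : ℕ} (Q : ∀ N : ℕ, Measure (Fin N → Vec M)) (θ : Vec K)
    (est : ∀ N : ℕ, (Fin N → Vec M) → Vec K) : Prop :=
  ∀ δ : ℝ, 0 < δ → Tendsto (fun N => Q N {x | δ ≤ ‖est N x - θ‖}) atTop (𝓝 0)

/-- Convergence in distribution of `√N (est N - θ)` to `𝒩(0, V)` under `Q N`. -/
def IsAsymptoticallyNormal {K M : ℕ} (Q : ∀ N : ℕ, Measure (Fin N → Vec M))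
    [∀ N, IsProbabilityMeasure (Q N)] (θ : Vec K)
    (est : ∀ N : ℕ, (Fin N → Vec M) → Vec K) (V : Matrix (Fin K) (Fin K) ℝ) : Prop :=
  TendstoInDistribution (fun (N : ℕ) x => Real.sqrt (N : ℝ) • (est N x - θ)) atTop
    (id : Vec K → Vec K) Q (multivariateGaussian 0 V)

/-- The estimation error has, for large `N`, a finite fourth moment and a kurtosis
`E‖ε‖⁴ / (E‖ε‖²)²` that is bounded in `N`. No rate in `N` is assumed of either moment. -/
def HasBoundedKurtosis {K M : ℕ} (Q : ∀ N : ℕ, Measure (Fin N → Vec M)) (θ : Vec K)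
    (est : ∀ N : ℕ, (Fin N → Vec M) → Vec K) : Prop :=
  ∃ C : ℝ, ∀ᶠ N : ℕ in atTop, MemLp (fun x => est N x - θ) 4 (Q N) ∧
    ∫ x, ‖est N x - θ‖ ^ 4 ∂(Q N) ≤ C * (∫ x, ‖est N x - θ‖ ^ 2 ∂(Q N)) ^ 2

instance {M : ℕ} (m : Vec M) (S : Matrix (Fin M) (Fin M) ℝ) (N : ℕ) :
    IsProbabilityMeasure (iidGaussian m S N) := by
  unfold iidGaussian; infer_instance

/-! The idea is to compare the mean square error under the true distribution with the one under the
assumed model. Write `W = ‖est - θ‖²`, a function of the sample mean. The Cauchy–Schwarz inequality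
in `L²(Q̄)`, applied to `W` and `dP̄/dQ̄ - 1`, gives
`E_P̄ W ≤ E_Q̄ W + (E_Q̄ W²)^(1/2) χ²(P̄‖Q̄)^(1/2)` (`lintegral_le_add_chiSqDiv`), and `Q̄` is
the law of the sample mean under the assumed model (`map_sampleMean_iidGaussian`). Since the
divergence is `o(N²)`, it suffices that `E_Q W = O(1/N)` and `E_Q W² = O(1/N²)`.

By the kurtosis bound the second estimate follows from the first. Asymptotic normality alone does
not control moments, but it makes the laws of `√N (est - θ)` tight
(`exists_eventually_measure_norm_ge_lt`). Under the kurtosis bound, the part of `E_Q W` carried by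
an event of small probability is at most `E_Q W / 2`, again by the Cauchy–Schwarz inequality, so
`E_Q W` is at most twice the truncation level (`lintegral_le_two_mul_of_sq_le`), which is of order
`1/N`. -/

/-! ### Truncation, tightness and change of measure -/

/-- The Cauchy–Schwarz inequality for functions with values in `[0, ∞]`. -/
theorem lintegral_mul_le_rpow_half {α : Type*} [MeasurableSpace α] {μ : Measure α}
    {f g : α → ENNReal} (hf : AEMeasurable f μ) (hg : AEMeasurable g μ) :
    ∫⁻ x, f x * g x ∂μ ≤
      (∫⁻ x, f x ^ 2 ∂μ) ^ (1 / 2 : ℝ) * (∫⁻ x, g x ^ 2 ∂μ) ^ (1 / 2 : ℝ) := by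
  simpa using ENNReal.lintegral_mul_le_Lp_mul_Lq μ Real.HolderConjugate.two_two hf hg

theorem ENNReal.rpow_half_sq (a : ENNReal) : (a ^ 2) ^ (1 / 2 : ℝ) = a := by
  rw [← ENNReal.rpow_natCast, ← ENNReal.rpow_mul]
  norm_num

/-- If the second moment of `W` is at most `C (E W)²`, then the mean of `W` is at most twice any
level that `W` exceeds only with small probability. -/
theorem lintegral_le_two_mul_of_sq_le {α : Type*} [MeasurableSpace α] {μ : Measure α}
    [IsProbabilityMeasure μ] {W : α → ENNReal} (hW : Measurable W) (hfin : ∫⁻ x, W x ∂μ ≠ ⊤)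
    {a C : ENNReal} (hC : ∫⁻ x, W x ^ 2 ∂μ ≤ C * (∫⁻ x, W x ∂μ) ^ 2)
    (ha : C * μ {x | a ≤ W x} ≤ (2⁻¹) ^ 2) :
    ∫⁻ x, W x ∂μ ≤ 2 * a := by
  set m := ∫⁻ x, W x ∂μ with hm
  set A : Set α := {x | a ≤ W x}
  have hA : MeasurableSet A := measurableSet_le measurable_const hW
  have hind : Measurable (A.indicator (1 : α → ENNReal)) := measurable_one.indicator hA
  have hsplit : m ≤ a + ∫⁻ x, W x * A.indicator 1 x ∂μ := by
    calc m ≤ ∫⁻ x, (a + W x * A.indicator 1 x) ∂μ := by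
          refine lintegral_mono fun x => ?_
          by_cases hx : x ∈ A
          · simp [hx]
          · have : W x ≤ a := (not_le.mp hx).le
            simpa [hx] using this
      _ = a + ∫⁻ x, W x * A.indicator 1 x ∂μ := by
          rw [lintegral_add_left measurable_const]
          simp
  have hsq : ∫⁻ x, (A.indicator (1 : α → ENNReal) x) ^ 2 ∂μ = μ A := by
    rw [← lintegral_indicator_one hA]
    refine lintegral_congr fun x => ?_
    by_cases hx : x ∈ A <;> simp [hx]
  have htail : ∫⁻ x, W x * A.indicator 1 x ∂μ ≤ m / 2 := by
    calc ∫⁻ x, W x * A.indicator 1 x ∂μ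
        ≤ (∫⁻ x, W x ^ 2 ∂μ) ^ (1 / 2 : ℝ) * (μ A) ^ (1 / 2 : ℝ) :=
          hsq ▸ lintegral_mul_le_rpow_half hW.aemeasurable hind.aemeasurable
      _ = ((∫⁻ x, W x ^ 2 ∂μ) * μ A) ^ (1 / 2 : ℝ) :=
          (ENNReal.mul_rpow_of_nonneg _ _ (by norm_num)).symm
      _ ≤ ((m / 2) ^ 2) ^ (1 / 2 : ℝ) := by
          refine ENNReal.rpow_le_rpow ?_ (by norm_num)
          calc (∫⁻ x, W x ^ 2 ∂μ) * μ A ≤ (C * m ^ 2) * μ A := by gcongr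
            _ = m ^ 2 * (C * μ A) := by ring
            _ ≤ m ^ 2 * (2⁻¹) ^ 2 := by gcongr
            _ = (m / 2) ^ 2 := by rw [div_eq_mul_inv, mul_pow]
      _ = m / 2 := ENNReal.rpow_half_sq _
  have hhalf : m / 2 ≠ ⊤ := ENNReal.div_ne_top hfin (by norm_num)
  have h1 : m / 2 + m / 2 ≤ a + m / 2 := by
    rw [ENNReal.add_halves]
    exact hsplit.trans (by gcongr)
  have h2 : m / 2 ≤ a := (ENNReal.add_le_add_iff_right hhalf).mp h1
  calc m = m / 2 + m / 2 := (ENNReal.add_halves m).symm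
    _ ≤ a + a := add_le_add h2 h2
    _ = 2 * a := (two_mul a).symm

/-- A sequence that converges in distribution is asymptotically tight: this is the portmanteau
inequality for the closed sets `{z | r ≤ ‖z‖}`, whose limit probability vanishes as `r → ∞`. -/
theorem exists_eventually_measure_norm_ge_lt {ι E Ω' : Type*} {Ω : ι → Type*}
    [∀ i, MeasurableSpace (Ω i)] {μ : ∀ i, Measure (Ω i)} [∀ i, IsProbabilityMeasure (μ i)]
    [MeasurableSpace Ω'] {μ' : Measure Ω'} [IsProbabilityMeasure μ'] [NormedAddCommGroup E]
    [MeasurableSpace E] [BorelSpace E] {X : ∀ i, Ω i → E} {Z : Ω' → E} {l : Filter ι}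
    (h : TendstoInDistribution X l Z μ μ') {δ : ENNReal} (hδ : 0 < δ) :
    ∃ r : ℝ, 0 < r ∧ ∀ᶠ i in l, μ i {ω | r ≤ ‖X i ω‖} < δ := by
  have hF (r : ℝ) : IsClosed {z : E | r ≤ ‖z‖} := isClosed_le continuous_const continuous_norm
  have : IsProbabilityMeasure (μ'.map Z) := Measure.isProbabilityMeasure_map h.aemeasurable_limit
  have hlim : Tendsto (fun n : ℕ => μ'.map Z {z : E | (n : ℝ) ≤ ‖z‖}) atTop (𝓝 0) := by
    have hempty : ⋂ n : ℕ, {z : E | (n : ℝ) ≤ ‖z‖} = ∅ := by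
      ext z
      obtain ⟨n, hn⟩ := exists_nat_gt ‖z‖
      simp only [Set.mem_iInter, Set.mem_ofPred_eq, Set.mem_empty_iff_false, iff_false, not_forall,
        not_le]
      exact ⟨n, hn⟩
    have := tendsto_measure_iInter_atTop (μ := μ'.map Z)
      (fun n : ℕ => (hF n).measurableSet.nullMeasurableSet)
      (fun m n hmn z (hz : (n : ℝ) ≤ ‖z‖) => le_trans (Nat.cast_le.mpr hmn) hz)
      ⟨0, measure_ne_top _ _⟩
    rwa [hempty, measure_empty] at this
  obtain ⟨n, hn, hn0⟩ := ((hlim.eventually (gt_mem_nhds hδ)).and (eventually_gt_atTop 0)).exists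
  refine ⟨n, Nat.cast_pos.mpr hn0, ?_⟩
  have hsup := ProbabilityMeasure.limsup_measure_closed_le_of_tendsto h.tendsto (hF n)
  filter_upwards [eventually_lt_of_limsup_lt (hsup.trans_lt hn)] with i hi
  have hi' : (μ i).map (X i) {z : E | (n : ℝ) ≤ ‖z‖} < δ := hi
  rwa [Measure.map_apply_of_aemeasurable (h.forall_aemeasurable i) (hF n).measurableSet] at hi'

/-- The change of measure inequality: `E_P g - E_Q g = E_Q [g (dP/dQ - 1)]`, and the right-hand side
is bounded by the Cauchy–Schwarz inequality. -/
theorem lintegral_le_add_chiSqDiv {α : Type*} [MeasurableSpace α] {P Q : Measure α}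
    [IsFiniteMeasure P] [IsFiniteMeasure Q] (hfin : chiSqDiv P Q ≠ ⊤) {g : α → ENNReal}
    (hg : Measurable g) :
    ∫⁻ y, g y ∂P ≤
      ∫⁻ y, g y ∂Q + (∫⁻ y, g y ^ 2 ∂Q) ^ (1 / 2 : ℝ) * (chiSqDiv P Q) ^ (1 / 2 : ℝ) := by
  by_cases hPQ : P ≪ Q
  swap
  · exact absurd (if_neg hPQ) hfin
  set L := P.rnDeriv Q
  have hχ : chiSqDiv P Q = ∫⁻ y, ENNReal.ofReal |(L y).toReal - 1| ^ 2 ∂Q := by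
    rw [chiSqDiv, if_pos hPQ]
    refine lintegral_congr fun y => ?_
    rw [← ENNReal.ofReal_pow (abs_nonneg _), sq_abs]
  have hd : Measurable fun y => ENNReal.ofReal |(L y).toReal - 1| := by
    have := (P.measurable_rnDeriv Q).ennreal_toReal.sub_const 1
    exact (measurable_norm.comp this).ennreal_ofReal
  rw [hχ]
  calc ∫⁻ y, g y ∂P = ∫⁻ y, L y * g y ∂Q := (lintegral_rnDeriv_mul hPQ hg.aemeasurable).symm
    _ ≤ ∫⁻ y, (g y + g y * ENNReal.ofReal |(L y).toReal - 1|) ∂Q := by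
        refine lintegral_mono_ae ?_
        filter_upwards [P.rnDeriv_lt_top Q] with y hy
        have hL : L y ≤ 1 + ENNReal.ofReal |(L y).toReal - 1| := by
          rw [← ENNReal.ofReal_one, ← ENNReal.ofReal_add zero_le_one (abs_nonneg _)]
          refine (ENNReal.ofReal_toReal hy.ne).symm.le.trans (ENNReal.ofReal_le_ofReal ?_)
          linarith [le_abs_self ((L y).toReal - 1)]
        calc L y * g y ≤ (1 + ENNReal.ofReal |(L y).toReal - 1|) * g y := by gcongr
          _ = g y + g y * ENNReal.ofReal |(L y).toReal - 1| := by ring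
    _ = ∫⁻ y, g y ∂Q + ∫⁻ y, g y * ENNReal.ofReal |(L y).toReal - 1| ∂Q :=
        lintegral_add_left hg _
    _ ≤ _ := by
        gcongr
        exact lintegral_mul_le_rpow_half hg.aemeasurable hd.aemeasurable

/-! ### The law of the sample mean -/

theorem measurable_sampleMean {M N : ℕ} :
    Measurable (sampleMean : (Fin N → Vec M) → Vec M) := by
  unfold sampleMean
  fun_prop

theorem map_sampleMean_iidGaussian {M : ℕ} (m : Vec M) {S : Matrix (Fin M) (Fin M) ℝ}
    (hS : S.PosSemidef) {N : ℕ} (hN : N ≠ 0) :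
    (iidGaussian m S N).map sampleMean = multivariateGaussian m ((N : ℝ)⁻¹ • S) := by
  have hsum : Measurable fun x : Fin N → Vec M => ∑ n, x n := by fun_prop
  have hSN : ((N : ℝ)⁻¹ • S).PosSemidef := hS.smul (by positivity)
  have : IsProbabilityMeasure ((iidGaussian m S N).map sampleMean) :=
    Measure.isProbabilityMeasure_map measurable_sampleMean.aemeasurable
  apply Measure.ext_of_charFun
  ext t
  have h1 : charFun ((iidGaussian m S N).map sampleMean) t =
      charFun ((iidGaussian m S N).map fun x => ∑ n, x n) ((N : ℝ)⁻¹ • t) :=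
    charFun_map_smul_comp hsum.aemeasurable _ _
  rw [h1, iidGaussian, charFun_map_sum_pi_eq_prod, charFun_multivariateGaussian hSN]
  simp only [Finset.prod_apply, charFun_multivariateGaussian hS, Finset.prod_const,
    Finset.card_univ, Fintype.card_fin]
  rw [← Complex.exp_nat_mul]
  congr 1
  have hNC : (N : ℂ) ≠ 0 := Nat.cast_ne_zero.mpr hN
  simp only [real_inner_smul_left, Matrix.smul_mulVec, Matrix.mulVec_smul, WithLp.ofLp_smul,
    smul_dotProduct, dotProduct_smul, smul_eq_mul]
  push_cast
  field_simp

/-! ### Moments of the estimation error -/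

/-- Under asymptotic normality and bounded kurtosis, the mean square error is `O(1/N)`, and the
fourth moment of the error is bounded by a multiple of its square. -/
theorem exists_mse_le {K M : ℕ} {Q : ∀ N : ℕ, Measure (Fin N → Vec M)}
    [∀ N, IsProbabilityMeasure (Q N)] {θ : Vec K} {est : ∀ N : ℕ, (Fin N → Vec M) → Vec K}
    {V : Matrix (Fin K) (Fin K) ℝ} (hest : ∀ N, Measurable (est N))
    (heff : IsAsymptoticallyNormal Q θ est V) (hkurt : HasBoundedKurtosis Q θ est) :
    ∃ B C : ENNReal, B ≠ ⊤ ∧ C ≠ ⊤ ∧ ∀ᶠ N : ℕ in atTop,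
      ∫⁻ x, ENNReal.ofReal (‖est N x - θ‖ ^ 2) ∂(Q N) ≤ B / N ∧
      ∫⁻ x, ENNReal.ofReal (‖est N x - θ‖ ^ 2) ^ 2 ∂(Q N) ≤ C * (B / N) ^ 2 := by
  obtain ⟨C, hC⟩ := hkurt
  -- `δ` is chosen so that `C * δ = 2⁻¹ ^ 2`, as the truncation argument requires; if `C ≤ 0`, then
  -- `δ = ⊤` and the requirement is void.
  have hδ : (0 : ENNReal) < 2⁻¹ ^ 2 / ENNReal.ofReal C :=
    ENNReal.div_pos (by simp) ENNReal.ofReal_ne_top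
  obtain ⟨r, hr, htight⟩ := exists_eventually_measure_norm_ge_lt heff hδ
  refine ⟨2 * ENNReal.ofReal (r ^ 2), ENNReal.ofReal C, by finiteness, ENNReal.ofReal_ne_top, ?_⟩
  filter_upwards [hC, htight, eventually_gt_atTop 0] with N ⟨hL4, hN4⟩ htN hN
  set W : (Fin N → Vec M) → ENNReal := fun x => ENNReal.ofReal (‖est N x - θ‖ ^ 2) with hW
  have hWm : Measurable W := (((hest N).sub_const θ).norm.pow_const 2).ennreal_ofReal
  have hI4 : Integrable (fun x => ‖est N x - θ‖ ^ 4) (Q N) := hL4.integrable_norm_pow (by norm_num)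
  have hI2 : Integrable (fun x => ‖est N x - θ‖ ^ 2) (Q N) :=
    (hL4.mono_exponent (p := 2) (by norm_num)).integrable_norm_pow (by norm_num)
  have hm : ∫⁻ x, W x ∂(Q N) = ENNReal.ofReal (∫ x, ‖est N x - θ‖ ^ 2 ∂(Q N)) :=
    (ofReal_integral_eq_lintegral_ofReal hI2 (ae_of_all _ fun x => by positivity)).symm
  have hm4 : ∫⁻ x, W x ^ 2 ∂(Q N) = ENNReal.ofReal (∫ x, ‖est N x - θ‖ ^ 4 ∂(Q N)) := by
    rw [ofReal_integral_eq_lintegral_ofReal hI4 (ae_of_all _ fun x => by positivity)]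
    refine lintegral_congr fun x => ?_
    rw [hW, ← ENNReal.ofReal_pow (by positivity), ← pow_mul]
  have hkurtN : ∫⁻ x, W x ^ 2 ∂(Q N) ≤ ENNReal.ofReal C * (∫⁻ x, W x ∂(Q N)) ^ 2 := by
    rw [hm, hm4, ← ENNReal.ofReal_pow (integral_nonneg fun x => by positivity),
      ← ENNReal.ofReal_mul' (by positivity)]
    exact ENNReal.ofReal_le_ofReal hN4
  have hNr : (0 : ℝ) < N := Nat.cast_pos.mpr hN
  -- The truncation level is `r² / N`, since `√N ‖est - θ‖ < r` with high probability.
  have hset : {x | ENNReal.ofReal (r ^ 2 / N) ≤ W x} =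
      {x | r ≤ ‖Real.sqrt (N : ℝ) • (est N x - θ)‖} := by
    ext x
    rw [Set.mem_ofPred_eq, Set.mem_ofPred_eq, hW, ENNReal.ofReal_le_ofReal_iff (by positivity),
      norm_smul, Real.norm_of_nonneg (Real.sqrt_nonneg _),
      ← pow_le_pow_iff_left₀ hr.le (by positivity) two_ne_zero, mul_pow, Real.sq_sqrt hNr.le,
      div_le_iff₀ hNr, mul_comm]
  have hmean : ∫⁻ x, W x ∂(Q N) ≤ 2 * ENNReal.ofReal (r ^ 2) / N := by
    have h2 := lintegral_le_two_mul_of_sq_le (a := ENNReal.ofReal (r ^ 2 / N)) hWm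
      (hm ▸ ENNReal.ofReal_ne_top) hkurtN (by
        rw [hset, mul_comm]
        exact ENNReal.mul_le_of_le_div htN.le)
    rwa [ENNReal.ofReal_div_of_pos hNr, ENNReal.ofReal_natCast, ← mul_div_assoc] at h2
  exact ⟨hmean, hkurtN.trans (by gcongr)⟩

/-! ### Consistency under the true distribution -/

theorem corollary2 {K M : ℕ} (Θ : Set (Vec K)) (θ : Vec K) (hθ : θ ∈ interior Θ)
    -- the assumed model: i.i.d. observations with distribution `𝒩(μ(θ), Λ(θ))`
    (μ : Vec K → Vec M) (Λ : Vec K → Matrix (Fin M) (Fin M) ℝ)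
    (hΛ : ∀ t ∈ Θ, (Λ t).PosDef) (hI : HasFisherInfo μ Λ θ)
    -- the Gaussian maximum likelihood estimator, computed from the sample mean
    (est : ∀ N : ℕ, (Fin N → Vec M) → Vec K) (hMLE : IsGaussianMLE Θ μ Λ θ est)
    (hmean : ∀ N : ℕ, ∃ T : Vec M → Vec K, Measurable T ∧ ∀ x, est N x = T (sampleMean x))
    -- its behaviour under the assumed model
    (hcons : IsConsistent (iidGaussian (μ θ) (Λ θ)) θ est)
    (heff : IsAsymptoticallyNormal (iidGaussian (μ θ) (Λ θ)) θ est (fisherInfo μ Λ θ)⁻¹)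
    (hkurt : HasBoundedKurtosis (iidGaussian (μ θ) (Λ θ)) θ est)
    -- the true data: a (possibly random) signal in zero-mean noise of arbitrary distribution
    {Ω : Type*} [MeasurableSpace Ω] (P : Measure Ω) [IsProbabilityMeasure P]
    (h : Ω → Vec K → Vec M) (hh : AEMeasurable (fun ω => h ω θ) P)
    (v : ℕ → Ω → Vec M) (hv : ∀ n, Integrable (v n) P) (hv0 : ∀ n, ∫ ω, v n ω ∂P = 0)
    (x : ℕ → Ω → Vec M) (hx : ∀ n ω, x n ω = h ω θ + v n ω)
    -- the true and the assumed distribution of the sample mean are at divergence `o(N²)`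
    (hχ : Tendsto (fun N : ℕ =>
        chiSqDiv (P.map (fun ω => sampleMean (fun n : Fin N => x n ω)))
          (multivariateGaussian (μ θ) ((N : ℝ)⁻¹ • Λ θ)) / (N : ENNReal) ^ 2)
      atTop (𝓝 0)) :
    Tendsto (fun N : ℕ => ∫⁻ ω, ENNReal.ofReal (‖est N (fun n : Fin N => x n ω) - θ‖ ^ 2) ∂P)
      atTop (𝓝 0) := by
  choose T hT hTest using hmean
  have hΛS : (Λ θ).PosSemidef := (hΛ θ (interior_subset hθ)).posSemidef
  have hest (N : ℕ) : Measurable (est N) := by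
    rw [show est N = T N ∘ sampleMean from funext (hTest N)]
    exact (hT N).comp measurable_sampleMean
  obtain ⟨B, C, hB, hC, hbound⟩ := exists_mse_le hest heff hkurt
  set χ : ℕ → ENNReal := fun N =>
    chiSqDiv (P.map (fun ω => sampleMean (fun n : Fin N => x n ω)))
      (multivariateGaussian (μ θ) ((N : ℝ)⁻¹ • Λ θ))
  have hmeas (N : ℕ) : AEMeasurable (fun ω => sampleMean (fun n : Fin N => x n ω)) P := by
    refine measurable_sampleMean.comp_aemeasurable (aemeasurable_pi_lambda _ fun n => ?_)
    rw [show x n = fun ω => h ω θ + v n ω from funext (hx n)]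
    exact hh.add (hv n).aemeasurable
  have hle : ∀ᶠ N : ℕ in atTop,
      ∫⁻ ω, ENNReal.ofReal (‖est N (fun n : Fin N => x n ω) - θ‖ ^ 2) ∂P ≤
        B / N + C ^ (1 / 2 : ℝ) * B * (χ N / (N : ENNReal) ^ 2) ^ (1 / 2 : ℝ) := by
    filter_upwards [hbound, eventually_ne_atTop 0,
      hχ.eventually (gt_mem_nhds ENNReal.zero_lt_top)] with N ⟨h1, h2⟩ hN hχN
    have hχfin : χ N ≠ ⊤ := by
      intro htop
      rw [show chiSqDiv _ _ = ⊤ from htop, ENNReal.top_div_of_ne_top (by finiteness)] at hχN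
      exact lt_irrefl _ hχN
    set g : Vec M → ENNReal := fun y => ENNReal.ofReal (‖T N y - θ‖ ^ 2)
    have hg : Measurable g := (((hT N).sub_const θ).norm.pow_const 2).ennreal_ofReal
    simp only [hTest] at h1 h2 ⊢
    have hlaw := map_sampleMean_iidGaussian (μ θ) hΛS hN
    rw [← lintegral_map (f := g) hg measurable_sampleMean, hlaw] at h1
    rw [← lintegral_map (f := fun y => g y ^ 2) (hg.pow_const 2) measurable_sampleMean,
      hlaw] at h2
    rw [← lintegral_map' (f := g) hg.aemeasurable (hmeas N)]
    refine (lintegral_le_add_chiSqDiv hχfin hg).trans (add_le_add h1 ?_)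
    calc _ ≤ (C * (B / N) ^ 2) ^ (1 / 2 : ℝ) * χ N ^ (1 / 2 : ℝ) := by gcongr
      _ = C ^ (1 / 2 : ℝ) * B * (χ N / (N : ENNReal) ^ 2) ^ (1 / 2 : ℝ) := by
        rw [ENNReal.mul_rpow_of_nonneg _ _ (by norm_num),
          ENNReal.div_rpow_of_nonneg _ _ (by norm_num), ENNReal.rpow_half_sq,
          ENNReal.rpow_half_sq, div_eq_mul_inv B, div_eq_mul_inv (χ N ^ (1 / 2 : ℝ))]
        ring
  have h1 : Tendsto (fun N : ℕ => B / (N : ENNReal)) atTop (𝓝 0) :=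
    ENNReal.Tendsto.const_div ENNReal.tendsto_nat_nhds_top (Or.inr hB) |>.trans (by simp)
  have h2 : Tendsto (fun N : ℕ => C ^ (1 / 2 : ℝ) * B * (χ N / (N : ENNReal) ^ 2) ^ (1 / 2 : ℝ))
      atTop (𝓝 0) := by
    have h3 := (ENNReal.continuous_rpow_const (y := (1 / 2 : ℝ))).tendsto 0 |>.comp hχ
    rw [ENNReal.zero_rpow_of_pos (by norm_num)] at h3
    simpa using ENNReal.Tendsto.const_mul h3 (a := C ^ (1 / 2 : ℝ) * B)
      (Or.inr (ENNReal.mul_ne_top (ENNReal.rpow_ne_top_of_nonneg (by norm_num) hC) hB))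
  refine tendsto_of_tendsto_of_tendsto_of_le_of_le' tendsto_const_nhds (by simpa using h1.add h2)
    (Eventually.of_forall fun N => zero_le) hle
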